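/- For a simple graph $\Gamma$, let $A(\Gamma)$ be the right-angled Artin group of $\Gamma$, that is, the group generated by the vertices of $\Gamma$ subject to the relations $ab=ba$ for all pairs of adjacent vertices $a,b$. Let $C_n$ be the cycle on $n$ vertices, and let $\Gamma^{\mathrm{opp}}$ be the complement graph of $\Gamma$ (same vertices; two distinct vertices are adjacent in $\Gamma^{\mathrm{opp}}$ if and only if they are not adjacent in $\Gamma$). A group $H$ embeds into a group $G$ (equivalently, $G$ contains $H$) if there is an injective group homomorphism $H\to G$. For every $n\ge 4$, the group $A(C_{n-1}^{\mathrm{opp}})$ embeds into $A(C_n^{\mathrm{opp}})$. In particular, $A(C_5)\cong A(C_5^{\mathrm{opp}})$, and $A(C_n^{\mathrm{opp}})$ contains $A(C_5)$ for every $n\ge 6$. -/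

import Mathlib

/-- The right-angled Artin group `A(Γ)` of a simple graph `Γ`: the generators are the vertices
of `Γ`, and the defining relations say that any two adjacent vertices commute. -/
abbrev RightAngledArtinGroup {V : Type*} (Γ : SimpleGraph V) : Type _ :=
  PresentedGroup
    {r : FreeGroup V | ∃ a b : V, Γ.Adj a b ∧
      r = FreeGroup.of a * FreeGroup.of b * (FreeGroup.of a)⁻¹ * (FreeGroup.of b)⁻¹}

/-- The group `H` embeds into the group `G` (equivalently, `G` contains `H`): there is an
injective group homomorphism from `H` to `G`. -/
def GroupEmbeds (H G : Type*) [Group H] [Group G] : Prop :=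
  ∃ f : H →* G, Function.Injective f

/-! Contracting an edge of a cycle shortens it by one; on complements this is a co-contraction along
a non-adjacent pair `v`, `none`. Sending `v` to its conjugate by `none` and fixing the other
generators embeds the group `G` of the co-contraction (`coContractionHom_injective`). To see this,
let `A(Γ)` act on two copies of `G`, with `none` swapping them and `v` moving only the second. The
conjugate of `v` then acts on the first copy as `v`, so the image of `w` acts there as left
multiplication by `w`, which determines `w`. Iterating from the self-complementary pentagon gives
the last claim. -/

namespace RightAngledArtinGroup

variable {V W : Type*} {Γ : SimpleGraph V} {Δ : SimpleGraph W}

/-- The generator of `A(Γ)` given by a vertex. -/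
def of (Γ : SimpleGraph V) (a : V) : RightAngledArtinGroup Γ :=
  PresentedGroup.of a

theorem commute_of {a b : V} (h : Γ.Adj a b) : Commute (of Γ a) (of Γ b) := by
  have : PresentedGroup.mk {r : FreeGroup V | ∃ a b : V, Γ.Adj a b ∧
      r = FreeGroup.of a * FreeGroup.of b * (FreeGroup.of a)⁻¹ * (FreeGroup.of b)⁻¹}
      (FreeGroup.of a * FreeGroup.of b * (FreeGroup.of a)⁻¹ * (FreeGroup.of b)⁻¹) = 1 :=
    PresentedGroup.one_of_mem ⟨a, b, h, rfl⟩
  rw [map_mul, map_mul, map_mul, map_inv, map_inv, mul_inv_eq_one, mul_inv_eq_iff_eq_mul] at this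
  exact this

/-- The universal property: a map on the vertices that sends adjacent vertices to commuting
elements extends to `A(Γ)`. -/
def lift {G : Type*} [Group G] (f : V → G) (hf : ∀ a b, Γ.Adj a b → Commute (f a) (f b)) :
    RightAngledArtinGroup Γ →* G :=
  PresentedGroup.toGroup (f := f) (by
    rintro _ ⟨a, b, h, rfl⟩
    simp only [map_mul, map_inv, FreeGroup.lift_apply_of]
    rw [(hf a b h).eq, mul_inv_cancel_right, mul_inv_cancel])

@[simp]
theorem lift_of {G : Type*} [Group G] (f : V → G)
    (hf : ∀ a b, Γ.Adj a b → Commute (f a) (f b)) (a : V) : lift f hf (of Γ a) = f a :=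
  PresentedGroup.toGroup.of _

theorem hom_ext {G : Type*} [Group G] {f g : RightAngledArtinGroup Γ →* G}
    (h : ∀ a, f (of Γ a) = g (of Γ a)) : f = g :=
  PresentedGroup.ext h

/-- Isomorphic graphs have isomorphic right-angled Artin groups. -/
def congr (e : Γ ≃g Δ) : RightAngledArtinGroup Γ ≃* RightAngledArtinGroup Δ :=
  MonoidHom.toMulEquiv
    (lift (fun a => of Δ (e a)) fun _ _ h => commute_of (e.map_rel_iff.2 h))
    (lift (fun a => of Γ (e.symm a)) fun _ _ h => commute_of (e.symm.map_rel_iff.2 h))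
    (hom_ext fun a => by simp) (hom_ext fun a => by simp)

/-- The co-contraction of a graph on `Option V` along the pair `{v, none}`: the pair becomes the
single vertex `v`, adjacent to the common neighbours of `some v` and `none`. -/
def coContraction (Γ : SimpleGraph (Option V)) (v : V) : SimpleGraph V where
  Adj x y := Γ.Adj (some x) (some y) ∧ (x = v → Γ.Adj none (some y)) ∧
    (y = v → Γ.Adj none (some x))
  symm := ⟨fun _ _ h => ⟨h.1.symm, h.2.2, h.2.1⟩⟩
  loopless := ⟨fun _ h => h.1.ne rfl⟩

section coContraction

variable (Γ : SimpleGraph (Option V)) (v : V)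

open Classical in
/-- The homomorphism that sends `v` to the conjugate of `v` by the removed vertex and fixes the
other generators. -/
noncomputable def coContractionHom :
    RightAngledArtinGroup (coContraction Γ v) →* RightAngledArtinGroup Γ :=
  lift (fun x => if x = v then of Γ none * of Γ (some v) * (of Γ none)⁻¹ else of Γ (some x)) <| by
    have key : ∀ y, (coContraction Γ v).Adj v y →
        Commute (of Γ none * of Γ (some v) * (of Γ none)⁻¹) (of Γ (some y)) := fun y h =>
      ((commute_of (h.2.1 rfl)).mul_left (commute_of h.1)).mul_left
        (commute_of (h.2.1 rfl)).inv_left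
    intro x y h
    by_cases hx : x = v <;> by_cases hy : y = v
    · exact (h.ne (hx.trans hy.symm)).elim
    · subst hx
      simpa [hy] using key y h
    · subst hy
      simpa [hx] using (key x h.symm).symm
    · simpa [hx, hy] using commute_of h.1

/-- Left multiplication by `g` on one copy of `G` and by `h` on a second copy. -/
def mulLeftPair {G : Type*} [Group G] : G × G →* Equiv.Perm (G ⊕ G) :=
  (Equiv.Perm.sumCongrHom G G).comp ((MulAction.toPermHom G G).prodMap (MulAction.toPermHom G G))

@[simp]
theorem mulLeftPair_inl {G : Type*} [Group G] (p : G × G) (k : G) :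
    mulLeftPair p (Sum.inl k) = Sum.inl (p.1 * k) := rfl

@[simp]
theorem mulLeftPair_inr {G : Type*} [Group G] (p : G × G) (k : G) :
    mulLeftPair p (Sum.inr k) = Sum.inr (p.2 * k) := rfl

open Classical in
/-- The pair of elements of the co-contraction by which the generator `x` acts on two copies of
its right-angled Artin group. -/
noncomputable def sheetPair (x : V) :
    RightAngledArtinGroup (coContraction Γ v) × RightAngledArtinGroup (coContraction Γ v) :=
  (if x = v then 1 else of _ x, if x = v ∨ Γ.Adj none (some x) then of _ x else 1)

/-- An edge of `Γ` can be missing from the co-contraction only if one end is `v` and the other is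
not adjacent to `none`. On each sheet one end of such an edge acts trivially: `v` on the first, the
other end on the second. -/
theorem commute_sheetPair (hv : ¬ Γ.Adj none (some v)) {x y : V} (h : Γ.Adj (some x) (some y)) :
    Commute (sheetPair Γ v x) (sheetPair Γ v y) := by
  have key : ∀ {x y}, Γ.Adj (some x) (some y) → (x = v → Γ.Adj none (some y)) →
      (y = v → Γ.Adj none (some x)) → Commute (of (coContraction Γ v) x) (of _ y) :=
    fun h h₁ h₂ => commute_of ⟨h, h₁, h₂⟩
  refine Commute.prod ?_ ?_
  · dsimp only [sheetPair]
    split_ifs with h₁ h₂ h₂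
    · exact Commute.one_left _
    · exact Commute.one_left _
    · exact Commute.one_right _
    · exact key h (fun e => (h₁ e).elim) (fun e => (h₂ e).elim)
  · dsimp only [sheetPair]
    split_ifs with h₁ h₂ h₂
    · refine key h ?_ ?_
      · rintro rfl
        exact h₂.resolve_left (fun e => h.ne (by rw [e]))
      · rintro rfl
        exact h₁.resolve_left (fun e => h.ne (by rw [e]))
    · exact Commute.one_right _
    · exact Commute.one_left _
    · exact Commute.one_left _

/-- The action of `A(Γ)` on two copies of the group of the co-contraction in which the removed
vertex exchanges the copies. -/
noncomputable def sheetAction (hv : ¬ Γ.Adj none (some v)) :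
    RightAngledArtinGroup Γ →* Equiv.Perm (RightAngledArtinGroup (coContraction Γ v) ⊕
      RightAngledArtinGroup (coContraction Γ v)) :=
  lift (fun x => x.elim (Equiv.sumComm _ _) fun x => mulLeftPair (sheetPair Γ v x)) <| by
    have key : ∀ x, Γ.Adj none (some x) →
        Commute (Equiv.sumComm _ _ : Equiv.Perm _) (mulLeftPair (sheetPair Γ v x)) := by
      intro x h
      -- So `x` acts by the same element on both sheets, and the swap commutes with it.
      have hx : x ≠ v := fun e => hv (e ▸ h)
      refine Equiv.ext ?_
      rintro (k | k) <;> simp [sheetPair, hx, h]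
    rintro (_ | x) (_ | y) h
    · exact (h.ne rfl).elim
    · exact key y h
    · exact (key x h.symm).symm
    · exact (commute_sheetPair Γ v hv h).map mulLeftPair

theorem sheetAction_coContractionHom (hv : ¬ Γ.Adj none (some v))
    (w k : RightAngledArtinGroup (coContraction Γ v)) :
    sheetAction Γ v hv (coContractionHom Γ v w) (Sum.inl k) = Sum.inl (w * k) := by
  have hgen : ∀ (x : V) k, sheetAction Γ v hv (coContractionHom Γ v (of _ x)) (Sum.inl k) =
      Sum.inl (of _ x * k) := by
    intro x k
    by_cases hx : x = v
    · subst hx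
      simp [coContractionHom, sheetAction, sheetPair]
    · simp [coContractionHom, sheetAction, sheetPair, hx]
  have hw : w ∈ Subgroup.closure (Set.range (of (coContraction Γ v))) := by
    have : Subgroup.closure (Set.range (of (coContraction Γ v))) = ⊤ :=
      PresentedGroup.closure_range_of _
    rw [this]
    trivial
  -- The point `k` must vary: products and inverses use the hypothesis at translates of `k`.
  induction hw using Subgroup.closure_induction generalizing k with
  | mem _ h =>
    obtain ⟨x, rfl⟩ := h
    exact hgen x k
  | one => simp
  | mul a b _ _ ha hb => rw [map_mul, map_mul, Equiv.Perm.mul_apply, hb, ha, mul_assoc]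
  | inv a _ ha => rw [map_inv, map_inv, Equiv.Perm.inv_eq_iff_eq, ha, mul_inv_cancel_left]

theorem coContractionHom_injective (hv : ¬ Γ.Adj none (some v)) :
    Function.Injective (coContractionHom Γ v) := by
  intro w₁ w₂ h
  have h₁ := sheetAction_coContractionHom Γ v hv w₁ 1
  rw [h, sheetAction_coContractionHom] at h₁
  simpa using h₁.symm

end coContraction

/-- Removes modular subtraction so that `omega` applies. For `n = 1` the wrap-around clauses would
give a loop. -/
theorem cycleGraph_adj_val {n : ℕ} (hn : 2 ≤ n) (x y : Fin n) :
    (SimpleGraph.cycleGraph n).Adj x y ↔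
      x.val + 1 = y.val ∨ y.val + 1 = x.val ∨ (x.val = 0 ∧ y.val + 1 = n) ∨
        (y.val = 0 ∧ x.val + 1 = n) := by
  rw [SimpleGraph.cycleGraph_adj']
  have hx := x.isLt
  have hy := y.isLt
  rcases lt_trichotomy x y with h | rfl | h
  · have h₁ := Fin.sub_val_of_le h.le
    have h₂ := Fin.coe_sub_iff_lt.2 h
    rw [h₁, h₂]
    rw [Fin.lt_def] at h
    omega
  · have : NeZero n := ⟨by omega⟩
    simp only [sub_self, Fin.val_zero]
    omega
  · have h₁ := Fin.sub_val_of_le h.le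
    have h₂ := Fin.coe_sub_iff_lt.2 h
    rw [h₁, h₂]
    rw [Fin.lt_def] at h
    omega

/-- The complement of the `n`-cycle is a co-contraction of the complement of the
`(n + 1)`-cycle. -/
theorem coContraction_compl_cycleGraph {n : ℕ} (hn : 3 ≤ n) :
    coContraction ((SimpleGraph.cycleGraph (n + 1))ᶜ.comap finSuccEquivLast.symm)
      ⟨0, by omega⟩ = (SimpleGraph.cycleGraph n)ᶜ := by
  ext x y
  have hx := x.isLt
  have hy := y.isLt
  simp only [coContraction, SimpleGraph.comap_adj, SimpleGraph.compl_adj,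
    finSuccEquivLast_symm_some, finSuccEquivLast_symm_none,
    cycleGraph_adj_val (show 2 ≤ n + 1 by omega), cycleGraph_adj_val (show 2 ≤ n by omega),
    Fin.ext_iff, ne_eq, Fin.val_castSucc, Fin.val_last]
  omega

theorem embeds_compl_cycleGraph_succ {n : ℕ} (hn : 3 ≤ n) :
    GroupEmbeds (RightAngledArtinGroup (SimpleGraph.cycleGraph n)ᶜ)
      (RightAngledArtinGroup (SimpleGraph.cycleGraph (n + 1))ᶜ) := by
  rw [← coContraction_compl_cycleGraph hn]
  have e : (SimpleGraph.cycleGraph (n + 1))ᶜ.comap finSuccEquivLast.symm ≃g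
      (SimpleGraph.cycleGraph (n + 1))ᶜ := SimpleGraph.Iso.comap finSuccEquivLast.symm _
  refine ⟨(congr e).toMonoidHom.comp (coContractionHom _ _),
    (congr e).injective.comp (coContractionHom_injective _ _ ?_)⟩
  -- The contracted pair is `0` and the last vertex, neighbours in the cycle and hence not in its
  -- complement.
  simp only [SimpleGraph.comap_adj, SimpleGraph.compl_adj, finSuccEquivLast_symm_some,
    finSuccEquivLast_symm_none, cycleGraph_adj_val (show 2 ≤ n + 1 by omega),
    Fin.val_castSucc, Fin.val_last]
  simp

/-- Multiplication by `2` modulo `5` identifies the pentagon with its complement. -/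
def cycleGraphFiveIsoCompl :
    SimpleGraph.cycleGraph 5 ≃g (SimpleGraph.cycleGraph 5)ᶜ where
  toFun x := 2 * x
  invFun x := 3 * x
  left_inv := by decide
  right_inv := by decide
  map_rel_iff' := by
    simp only [SimpleGraph.compl_adj, SimpleGraph.cycleGraph_adj', Equiv.coe_fn_mk]
    decide

end RightAngledArtinGroup

theorem GroupEmbeds.trans {G H K : Type*} [Group G] [Group H] [Group K]
    (h₁ : GroupEmbeds G H) (h₂ : GroupEmbeds H K) : GroupEmbeds G K :=
  let ⟨f, hf⟩ := h₁
  let ⟨g, hg⟩ := h₂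
  ⟨g.comp f, hg.comp hf⟩

theorem corollaryc :
    (∀ n : ℕ, 4 ≤ n →
      GroupEmbeds (RightAngledArtinGroup (SimpleGraph.cycleGraph (n - 1))ᶜ)
        (RightAngledArtinGroup (SimpleGraph.cycleGraph n)ᶜ)) ∧
    Nonempty (RightAngledArtinGroup (SimpleGraph.cycleGraph 5) ≃*
      RightAngledArtinGroup (SimpleGraph.cycleGraph 5)ᶜ) ∧
    (∀ n : ℕ, 6 ≤ n →
      GroupEmbeds (RightAngledArtinGroup (SimpleGraph.cycleGraph 5))
        (RightAngledArtinGroup (SimpleGraph.cycleGraph n)ᶜ)) := by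
  have e := RightAngledArtinGroup.congr RightAngledArtinGroup.cycleGraphFiveIsoCompl
  refine ⟨fun n hn => ?_, ⟨e⟩, fun n hn => ?_⟩
  · obtain ⟨m, rfl⟩ := Nat.exists_eq_add_of_le' (show 1 ≤ n by omega)
    exact RightAngledArtinGroup.embeds_compl_cycleGraph_succ (by omega)
  · have hn5 : 5 ≤ n := by omega
    clear hn
    induction n, hn5 using Nat.le_induction with
    | base => exact ⟨e.toMonoidHom, e.injective⟩
    | succ n h ih =>
      exact ih.trans (RightAngledArtinGroup.embeds_compl_cycleGraph_succ (by omega))
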